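/- Let $p,q\ge 0$ be integers. Let $P(\mathbb R^q)$ be the space with real coordinates $(u^\alpha_{\mathbf J})$, $\alpha=1,\dots,q$, $\mathbf J\in\mathbb Z^p$ (the Cartesian product of copies of $\mathbb R$ indexed by the pairs $(\alpha,\mathbf J)$), and let $P_{\mathbf n}(\mathbb R^q)$ denote its copy over $\mathbf n\in\mathbb Z^p$. Let $\Delta^1,\dots,\Delta^p$ be the generators of an exterior algebra over $\mathbb R$. For $k,l\ge 0$ let $\Omega^{k,l}$ be the real vector space of $(k,l)$-forms on $\mathbb Z^p\times P(\mathbb R^q)$: a $(k,l)$-form $\sigma$ assigns to each $\mathbf n\in\mathbb Z^p$ a finite sum $$\sigma_{\mathbf n}=\sum f^{\mathbf J_1,\dots,\mathbf J_l}_{i_1,\dots,i_k;\alpha_1,\dots,\alpha_l}(\mathbf n,[\mathbf u])\,\Delta^{i_1}\wedge\cdots\wedge\Delta^{i_k}\wedge \mathrm d_{\mathrm v}u^{\alpha_1}_{\mathbf J_1}\wedge\cdots\wedge \mathrm d_{\mathrm v}u^{\alpha_l}_{\mathbf J_l},$$ whose coefficients are, for each fixed $\mathbf n$, $C^\infty$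 functions on $P_{\mathbf n}(\mathbb R^q)$ of a finite subset $[\mathbf u]$ (which may depend on $\mathbf n$) of the coordinates $u^\alpha_{\mathbf J}$. The vertical exterior derivative $\mathrm d_{\mathrm v}:\Omega^{k,l}\to\Omega^{k,l+1}$ is the linear map which acts, for each $\mathbf n$, by $$\mathrm d_{\mathrm v}\bigl(f\,\Delta^{i_1}\wedge\cdots\wedge\Delta^{i_k}\wedge \mathrm d_{\mathrm v}u^{\alpha_1}_{\mathbf J_1}\wedge\cdots\wedge \mathrm d_{\mathrm v}u^{\alpha_l}_{\mathbf J_l}\bigr)=\sum_{\alpha,\mathbf J}\frac{\partial f}{\partial u^\alpha_{\mathbf J}}\,\mathrm d_{\mathrm v}u^\alpha_{\mathbf J}\wedge\Delta^{i_1}\wedge\cdots\wedge\Delta^{i_k}\wedge \mathrm d_{\mathrm v}u^{\alpha_1}_{\mathbf J_1}\wedge\cdots\wedge \mathrm d_{\mathrm v}u^{\alpha_l}_{\mathbf J_l}.$$ **Theorem.** For each $k=0,1,\dots,p$, the vertical complex $$\Omega^{k,0}\xrightarrow{\ \mathrm d_{\mathrm v}\ }\Omega^{k,1}\xrightarrow{\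 \mathrm d_{\mathrm v}\ }\Omega^{k,2}\xrightarrow{\ \mathrm d_{\mathrm v}\ }\cdots$$ is exact; that is, for every $l\ge 1$, the kernel of $\mathrm d_{\mathrm v}:\Omega^{k,l}\to\Omega^{k,l+1}$ equals the image of $\mathrm d_{\mathrm v}:\Omega^{k,l-1}\to\Omega^{k,l}$. -/

import Mathlib

open scoped ContDiff

/-- Labels `(α, J)` of the coordinates `u^α_J`, `α = 1, …, q`, `J ∈ ℤ^p`. -/
abbrev Coord (p q : ℕ) : Type := Fin q × (Fin p → ℤ)

/-- The total prolongation space `P(ℝ^q)` over a base point of `ℤ^p`: the Cartesian product with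
coordinates `(u^α_J)`. -/
abbrev Prolong (p q : ℕ) : Type := Coord p q → ℝ

/-- Horizontal `k`-covectors: the degree `k` part of the exterior algebra on the symbols
`Δ^1, …, Δ^p`, realised as alternating `k`-forms on `ℝ^p`, with `Δ^i` the `i`-th coordinate
covector. The coefficient of `Δ^{i_1} ∧ ⋯ ∧ Δ^{i_k}` (`i_1 < ⋯ < i_k`) in `θ` is
`θ (e_{i_1}, …, e_{i_k})`. -/
abbrev HCovector (p k : ℕ) : Type := (Fin p → ℝ) [⋀^Fin k]→L[ℝ] ℝ

/-- Fields of vertical `l`-covectors with values in horizontal `k`-covectors, on `P(ℝ^q)`.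
In the field `σ` on one fibre, the coefficient (a function of `u`) of
`Δ^{i_1} ∧ ⋯ ∧ Δ^{i_k} ∧ d_v u^{α_1}_{J_1} ∧ ⋯ ∧ d_v u^{α_l}_{J_l}` (distinct `i`'s and distinct
`(α, J)`'s, each wedge product written once, in one chosen order of its factors) is
`σ u (∂/∂u^{α_1}_{J_1}, …, ∂/∂u^{α_l}_{J_l}) (e_{i_1}, …, e_{i_k})`. -/
abbrev FibreForm (p q k l : ℕ) : Type := Prolong p q → Prolong p q [⋀^Fin l]→L[ℝ] HCovector p k

/-- The projection of `P(ℝ^q)` onto finitely many of its coordinates. -/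
noncomputable def coordProj {p q : ℕ} (F : Finset (Coord p q)) : Prolong p q →L[ℝ] (F → ℝ) :=
  ContinuousLinearMap.pi fun a => ContinuousLinearMap.proj (a : Coord p q)

/-- The pullback of a differential form on `ℝ^F`, `F` a finite set of coordinates, to `P(ℝ^q)`. -/
noncomputable def pullbackForm {p q k l : ℕ} (F : Finset (Coord p q))
    (β : (F → ℝ) → (F → ℝ) [⋀^Fin l]→L[ℝ] HCovector p k) : FibreForm p q k l :=
  fun u => (β (coordProj F u)).compContinuousLinearMap (coordProj F)

/-- `σ` is a finite sum of terms `f([u]) Δ^{i_1} ∧ ⋯ ∧ Δ^{i_k} ∧ d_v u^{α_1}_{J_1} ∧ ⋯` with smooth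
coefficients that depend on finitely many of the coordinates: equivalently, it is the pullback of
a smooth form in finitely many of the coordinates. -/
def IsSmoothFinite {p q k l : ℕ} (σ : FibreForm p q k l) : Prop :=
  ∃ (F : Finset (Coord p q)) (β : (F → ℝ) → (F → ℝ) [⋀^Fin l]→L[ℝ] HCovector p k),
    ContDiff ℝ ∞ β ∧ σ = pullbackForm F β

theorem exists_pullbackForm_of_subset {p q k l : ℕ} {F G : Finset (Coord p q)} (h : F ⊆ G)
    {β : (F → ℝ) → (F → ℝ) [⋀^Fin l]→L[ℝ] HCovector p k} (hβ : ContDiff ℝ ∞ β) :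
    ∃ β' : (G → ℝ) → (G → ℝ) [⋀^Fin l]→L[ℝ] HCovector p k,
      ContDiff ℝ ∞ β' ∧ pullbackForm F β = pullbackForm G β' := by
  let r : (G → ℝ) →L[ℝ] (F → ℝ) :=
    ContinuousLinearMap.pi fun a => ContinuousLinearMap.proj (⟨a.1, h a.2⟩ : G)
  refine ⟨fun x => ContinuousAlternatingMap.compContinuousLinearMapCLM r (β (r x)), ?_, ?_⟩
  · exact (ContinuousLinearMap.contDiff _).comp (hβ.comp r.contDiff)
  · rfl

theorem IsSmoothFinite.add {p q k l : ℕ} {σ τ : FibreForm p q k l} (hσ : IsSmoothFinite σ)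
    (hτ : IsSmoothFinite τ) : IsSmoothFinite (σ + τ) := by
  classical
  obtain ⟨F, β, hβ, rfl⟩ := hσ
  obtain ⟨G, η, hη, rfl⟩ := hτ
  obtain ⟨β', hβ', e⟩ := exists_pullbackForm_of_subset (Finset.subset_union_left (s₂ := G)) hβ
  obtain ⟨η', hη', e'⟩ := exists_pullbackForm_of_subset (Finset.subset_union_right (s₁ := F)) hη
  exact ⟨F ∪ G, β' + η', hβ'.add hη', by rw [e, e']; rfl⟩

theorem IsSmoothFinite.smul {p q k l : ℕ} {σ : FibreForm p q k l} (c : ℝ)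
    (hσ : IsSmoothFinite σ) : IsSmoothFinite (c • σ) := by
  obtain ⟨F, β, hβ, rfl⟩ := hσ
  exact ⟨F, c • β, hβ.const_smul c, rfl⟩

theorem IsSmoothFinite.zero {p q k l : ℕ} : IsSmoothFinite (0 : FibreForm p q k l) :=
  ⟨∅, 0, contDiff_const, rfl⟩

/-- The space `Ω^{k,l}` of `(k,l)`-forms on `ℤ^p × P(ℝ^q)`: to each `n ∈ ℤ^p` is assigned a form on
`P_n(ℝ^q)` of bidegree `(k,l)` that involves finitely many of the coordinates, smoothly. -/
def Omega (p q k l : ℕ) : Submodule ℝ ((Fin p → ℤ) → FibreForm p q k l) where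
  carrier := {σ | ∀ n, IsSmoothFinite (σ n)}
  add_mem' hσ hτ n := (hσ n).add (hτ n)
  zero_mem' _ := IsSmoothFinite.zero
  smul_mem' c _ hσ n := (hσ n).smul c

/-- The vertical exterior derivative of `σ` at `u`, on the vectors `w_0, …, w_l`:
`(-1)^k ∑_i (-1)^i ∂_{w_i} σ(w_0, …, ŵ_i, …, w_l)`. The directional derivative `∂_w` is
`∑ w^α_J ∂/∂u^α_J`; the sign `(-1)^k` comes from `d_v u^α_J` being wedged in front of
`Δ^{i_1} ∧ ⋯ ∧ Δ^{i_k}` in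
`d_v (f Δ^{i_1} ∧ ⋯ ∧ Δ^{i_k} ∧ ⋯) = (∂f/∂u^α_J) d_v u^α_J ∧ Δ^{i_1} ∧ ⋯ ∧ Δ^{i_k} ∧ ⋯`. -/
noncomputable def vertDerivAt {p q k l : ℕ} (σ : FibreForm p q k l) (u : Prolong p q)
    (w : Fin (l + 1) → Prolong p q) : HCovector p k :=
  (-1 : ℝ) ^ k • ∑ i : Fin (l + 1),
    (-1 : ℝ) ^ (i : ℕ) • lineDeriv ℝ (fun x => σ x (i.removeNth w)) u (w i)

theorem hasLineDerivAt_pullbackForm {p q k l : ℕ} {F : Finset (Coord p q)}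
    {β : (F → ℝ) → (F → ℝ) [⋀^Fin l]→L[ℝ] HCovector p k} (hβ : ContDiff ℝ ∞ β)
    (u v : Prolong p q) (w : Fin l → Prolong p q) :
    HasLineDerivAt ℝ (fun x => pullbackForm F β x w)
      (fderiv ℝ β (coordProj F u) (coordProj F v) (coordProj F ∘ w)) u v := by
  have h1 : HasFDerivAt β (fderiv ℝ β (coordProj F u)) (coordProj F u) :=
    (hβ.differentiable (by simp) _).hasFDerivAt
  have h2 := HasFDerivAt.hasLineDerivAt (𝕜 := ℝ) (f := β) h1 (coordProj F v)
  unfold HasLineDerivAt at h2 ⊢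
  have h3 := (ContinuousAlternatingMap.apply ℝ (F → ℝ) (HCovector p k)
    (coordProj F ∘ w)).hasFDerivAt.comp_hasDerivAt (0 : ℝ) h2
  refine h3.congr_of_eventuallyEq (Filter.Eventually.of_forall fun t => ?_)
  simp only [pullbackForm, map_add, map_smul]
  rfl

theorem vertDerivAt_pullbackForm {p q k l : ℕ} {F : Finset (Coord p q)}
    {β : (F → ℝ) → (F → ℝ) [⋀^Fin l]→L[ℝ] HCovector p k} (hβ : ContDiff ℝ ∞ β)
    (u : Prolong p q) (w : Fin (l + 1) → Prolong p q) :
    vertDerivAt (pullbackForm F β) u w =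
      pullbackForm F (fun x => (-1 : ℝ) ^ k • extDeriv β x) u w := by
  simp only [vertDerivAt, (hasLineDerivAt_pullbackForm hβ _ _ _).lineDeriv]
  simp only [pullbackForm, extDeriv, ContinuousAlternatingMap.compContinuousLinearMap_apply,
    ContinuousAlternatingMap.smul_apply, ContinuousAlternatingMap.alternatizeUncurryFin_apply]
  congr 1
  refine Finset.sum_congr rfl fun i _ => ?_
  rw [← Int.cast_smul_eq_zsmul ℝ]
  push_cast
  rfl

theorem contDiff_extDeriv {p k l : ℕ} {E : Type} [NormedAddCommGroup E] [NormedSpace ℝ E]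
    {β : E → E [⋀^Fin l]→L[ℝ] HCovector p k} (hβ : ContDiff ℝ ∞ β) :
    ContDiff ℝ ∞ (extDeriv β) :=
  (ContinuousAlternatingMap.alternatizeUncurryFinCLM ℝ E (HCovector p k)).contDiff.comp
    (hβ.fderiv_right (by simp))

theorem exists_vertDeriv {p q k l : ℕ} (σ : Omega p q k l) :
    ∃ τ : Omega p q k (l + 1), ∀ n u w, τ.1 n u w = vertDerivAt (σ.1 n) u w := by
  choose F β hβ e using σ.2
  refine ⟨⟨fun n => pullbackForm (F n) (fun x => (-1 : ℝ) ^ k • extDeriv (β n) x), fun n =>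
    ⟨F n, _, (contDiff_extDeriv (hβ n)).const_smul _, rfl⟩⟩, fun n u w => ?_⟩
  rw [e n, vertDerivAt_pullbackForm (hβ n)]

theorem vertDerivAt_add {p q k l : ℕ} (σ τ : Omega p q k l) (n : Fin p → ℤ) (u : Prolong p q)
    (w : Fin (l + 1) → Prolong p q) :
    vertDerivAt ((σ + τ).1 n) u w = vertDerivAt (σ.1 n) u w + vertDerivAt (τ.1 n) u w := by
  obtain ⟨F, β, hβ, e⟩ := σ.2 n
  obtain ⟨G, η, hη, e'⟩ := τ.2 n
  have h : ∀ i : Fin (l + 1), lineDeriv ℝ (fun x => (σ + τ).1 n x (i.removeNth w)) u (w i) =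
      lineDeriv ℝ (fun x => σ.1 n x (i.removeNth w)) u (w i) +
        lineDeriv ℝ (fun x => τ.1 n x (i.removeNth w)) u (w i) := by
    intro i
    rw [e, e', (hasLineDerivAt_pullbackForm hβ _ _ _).lineDeriv,
      (hasLineDerivAt_pullbackForm hη _ _ _).lineDeriv]
    have := HasDerivAt.add (hasLineDerivAt_pullbackForm hβ u (w i) (i.removeNth w))
      (hasLineDerivAt_pullbackForm hη u (w i) (i.removeNth w))
    rw [← e, ← e'] at this
    exact HasDerivAt.deriv this
  simp only [vertDerivAt, h, smul_add, Finset.sum_add_distrib]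

theorem vertDerivAt_smul {p q k l : ℕ} (c : ℝ) (σ : Omega p q k l) (n : Fin p → ℤ)
    (u : Prolong p q) (w : Fin (l + 1) → Prolong p q) :
    vertDerivAt ((c • σ).1 n) u w = c • vertDerivAt (σ.1 n) u w := by
  obtain ⟨F, β, hβ, e⟩ := σ.2 n
  have h : ∀ i : Fin (l + 1), lineDeriv ℝ (fun x => (c • σ).1 n x (i.removeNth w)) u (w i) =
      c • lineDeriv ℝ (fun x => σ.1 n x (i.removeNth w)) u (w i) := by
    intro i
    rw [e, (hasLineDerivAt_pullbackForm hβ _ _ _).lineDeriv]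
    have := HasDerivAt.const_smul c (hasLineDerivAt_pullbackForm hβ u (w i) (i.removeNth w))
    rw [← e] at this
    exact HasDerivAt.deriv this
  simp only [vertDerivAt, h, Finset.smul_sum]
  simp only [smul_comm c]

/-- The vertical exterior derivative `d_v : Ω^{k,l} → Ω^{k,l+1}`: the form `d_v σ` is the one whose
values are given by `vertDerivAt` (see `dv_apply`). -/
noncomputable def dv (p q k l : ℕ) : Omega p q k l →ₗ[ℝ] Omega p q k (l + 1) where
  toFun σ := (exists_vertDeriv σ).choose
  map_add' σ τ := by
    ext1; ext1 n; ext1 u; ext1 w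
    rw [(exists_vertDeriv (σ + τ)).choose_spec, vertDerivAt_add]
    exact (congrArg₂ (· + ·) ((exists_vertDeriv σ).choose_spec n u w)
      ((exists_vertDeriv τ).choose_spec n u w)).symm
  map_smul' c σ := by
    ext1; ext1 n; ext1 u; ext1 w
    rw [(exists_vertDeriv (c • σ)).choose_spec, vertDerivAt_smul]
    exact (congrArg (c • ·) ((exists_vertDeriv σ).choose_spec n u w)).symm

theorem dv_apply {p q k l : ℕ} (σ : Omega p q k l) (n : Fin p → ℤ) (u : Prolong p q)
    (w : Fin (l + 1) → Prolong p q) :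
    (dv p q k l σ).1 n u w = vertDerivAt (σ.1 n) u w :=
  (exists_vertDeriv σ).choose_spec n u w

/-! Over each base point a form is a pullback from some `ℝ^F` with `F` finite, and there `d_v` is
`(-1)^k` times the exterior derivative, the horizontal covectors being mere constant values.
Exactness thus reduces to the Poincaré lemma on `ℝ^F`. For a closed `β` of degree `n + 1`, the
radial primitive is `η x = ∫₀¹ t^n ι_x β(t x) dt`: by a Cartan-type identity, closedness makes the
exterior derivative in `x` of the integrand equal to `d/dt (t^(n+1) β(t x))`, which integrates to `β
x`. The primitive uses the same variables `F`, so it is again a finite smooth form. -/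

open MeasureTheory intervalIntegral in
/-- Differentiation under the integral sign for a `C^1` function on a proper space. -/
theorem hasFDerivAt_intervalIntegral_of_contDiff {E G : Type*} [NormedAddCommGroup E]
    [NormedSpace ℝ E] [ProperSpace E] [NormedAddCommGroup G] [NormedSpace ℝ G]
    {f : E × ℝ → G} (hf : ContDiff ℝ 1 f) (a b : ℝ) (x : E) :
    HasFDerivAt (fun x => ∫ t in a..b, f (x, t))
      (∫ t in a..b, (fderiv ℝ f (x, t)).comp (ContinuousLinearMap.inl ℝ E ℝ)) x := by
  have hc : Continuous fun z : E × ℝ => (fderiv ℝ f z).comp (ContinuousLinearMap.inl ℝ E ℝ) :=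
    (hf.continuous_fderiv (by simp)).clm_comp continuous_const
  -- Properness makes the closed ball compact, so one constant dominates the derivative near `x` for
  -- all `t` between `a` and `b`.
  obtain ⟨C, hC⟩ := ((isCompact_closedBall x 1).prod (isCompact_uIcc (a := a) (b := b))
    ).exists_bound_of_continuousOn hc.continuousOn
  refine hasFDerivAt_integral_of_dominated_of_fderiv_le (μ := volume)
    (F := fun x t => f (x, t))
    (F' := fun x t => (fderiv ℝ f (x, t)).comp (ContinuousLinearMap.inl ℝ E ℝ))
    (bound := fun _ => C) (Metric.ball_mem_nhds x one_pos) ?_ ?_ ?_ ?_ ?_ ?_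
  · exact Filter.Eventually.of_forall fun y =>
      (hf.continuous.comp (by fun_prop : Continuous fun t : ℝ => (y, t))).aestronglyMeasurable
  · exact (hf.continuous.comp (by fun_prop : Continuous fun t : ℝ => (x, t))).intervalIntegrable _ _
  · exact (hc.comp (by fun_prop : Continuous fun t : ℝ => (x, t))).aestronglyMeasurable
  · exact Filter.Eventually.of_forall fun t ht y hy =>
      hC (y, t) ⟨Metric.ball_subset_closedBall hy, Set.uIoc_subset_uIcc ht⟩
  · exact intervalIntegrable_const
  · exact Filter.Eventually.of_forall fun t _ y _ =>
      ((hf.differentiable (by simp) (y, t)).hasFDerivAt).comp y (hasFDerivAt_prodMk_left y t)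

/-- If the partial derivative of `f` in `x`, after applying a continuous linear map, has a primitive
in `t`, then the derivative of the parametric integral of `f` is given by that primitive. -/
theorem clm_fderiv_intervalIntegral_eq_sub {E G H : Type*} [NormedAddCommGroup E]
    [NormedSpace ℝ E] [ProperSpace E] [NormedAddCommGroup G] [NormedSpace ℝ G] [CompleteSpace G]
    [NormedAddCommGroup H] [NormedSpace ℝ H] [CompleteSpace H]
    {f : E × ℝ → G} (hf : ContDiff ℝ 1 f) (a b : ℝ) (x : E) (L : (E →L[ℝ] G) →L[ℝ] H) {φ : ℝ → H}
    (hφ : ∀ t, HasDerivAt φ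
      (L ((fderiv ℝ f (x, t)).comp (ContinuousLinearMap.inl ℝ E ℝ))) t) :
    L (fderiv ℝ (fun x => ∫ t in a..b, f (x, t)) x) = φ b - φ a := by
  have hc : Continuous fun t : ℝ => (fderiv ℝ f (x, t)).comp (ContinuousLinearMap.inl ℝ E ℝ) :=
    ((hf.continuous_fderiv (by simp)).comp
      (by fun_prop : Continuous fun t : ℝ => (x, t))).clm_comp continuous_const
  rw [(hasFDerivAt_intervalIntegral_of_contDiff hf a b x).fderiv,
    ← ContinuousLinearMap.intervalIntegral_comp_comm _ (hc.intervalIntegrable a b),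
    intervalIntegral.integral_eq_sub_of_hasDerivAt (fun t _ => hφ t)
      ((L.continuous.comp hc).intervalIntegrable a b)]

/-- Each derivative is again a parametric integral, with values in `E →L[ℝ] G`; hence the induction
quantifies over `G`. -/
theorem contDiff_nat_intervalIntegral {E : Type} [NormedAddCommGroup E] [NormedSpace ℝ E]
    [ProperSpace E] (a b : ℝ) (n : ℕ) : ∀ {G : Type} [NormedAddCommGroup G] [NormedSpace ℝ G]
    {f : E × ℝ → G}, ContDiff ℝ ∞ f → ContDiff ℝ n (fun x => ∫ t in a..b, f (x, t)) := by
  induction n with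
  | zero =>
    intro G _ _ f hf
    refine contDiff_zero.2 (continuous_iff_continuousAt.2 fun x => ?_)
    exact (hasFDerivAt_intervalIntegral_of_contDiff (hf.of_le (by simp)) a b x).continuousAt
  | succ n ih =>
    intro G _ _ f hf
    refine contDiff_succ_iff_hasFDerivAt.2 ⟨_, ?_, fun x =>
      hasFDerivAt_intervalIntegral_of_contDiff (hf.of_le (by simp)) a b x⟩
    exact ih (f := fun z => (fderiv ℝ f z).comp (ContinuousLinearMap.inl ℝ E ℝ))
      ((hf.fderiv_right (by simp)).clm_comp contDiff_const)

/-- Smoothness of an integral of a smooth function with respect to a parameter. -/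
theorem contDiff_intervalIntegral {E G : Type} [NormedAddCommGroup E] [NormedSpace ℝ E]
    [ProperSpace E] [NormedAddCommGroup G] [NormedSpace ℝ G] {f : E × ℝ → G}
    (hf : ContDiff ℝ ∞ f) (a b : ℝ) : ContDiff ℝ ∞ (fun x => ∫ t in a..b, f (x, t)) :=
  contDiff_infty.2 fun n => contDiff_nat_intervalIntegral a b n hf

/-! ### The Poincaré lemma via the radial homotopy -/

section Poincare

open ContinuousAlternatingMap

variable {E G : Type} [NormedAddCommGroup E] [NormedSpace ℝ E] [NormedAddCommGroup G]
  [NormedSpace ℝ G] {n : ℕ}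

/-- The interior product `(β, x) ↦ ι_x β`, as a continuous linear map in `β`. -/
noncomputable def curryLeftCLM (E G : Type) [NormedAddCommGroup E] [NormedSpace ℝ E]
    [NormedAddCommGroup G] [NormedSpace ℝ G] (n : ℕ) :
    E [⋀^Fin (n + 1)]→L[ℝ] G →L[ℝ] E →L[ℝ] E [⋀^Fin n]→L[ℝ] G :=
  (curryLeftLI (𝕜 := ℝ) (E := E) (F := G) (n := n)).toContinuousLinearMap

theorem curryLeftCLM_apply (β : E [⋀^Fin (n + 1)]→L[ℝ] G) (x : E) :
    curryLeftCLM E G n β x = β.curryLeft x := rfl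

/-- Pointwise Cartan formula: in the alternating sum, the term `i = 0` differentiates along `x`; the
others keep `x` in the first slot, and the index shift costs a sign. -/
theorem curryLeft_alternatizeUncurryFin (f : E →L[ℝ] E [⋀^Fin (n + 1)]→L[ℝ] G) (x : E) :
    (alternatizeUncurryFin f).curryLeft x =
      f x - alternatizeUncurryFin (((curryLeftCLM E G n).flip x).comp f) := by
  ext v
  rw [ContinuousAlternatingMap.sub_apply]
  simp only [curryLeft_apply_apply, alternatizeUncurryFin_apply]
  rw [Fin.sum_univ_succ, sub_eq_add_neg, ← Finset.sum_neg_distrib]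
  congr 1
  · simp [Matrix.vecCons, Fin.removeNth_zero]
  · refine Finset.sum_congr rfl fun i _ => ?_
    have h : i.succ.removeNth (Matrix.vecCons x v) = Matrix.vecCons x (i.removeNth v) := by
      funext j
      refine Fin.cases ?_ (fun j => ?_) j
      · simp [Fin.removeNth, Matrix.vecCons]
      · simp [Fin.removeNth, Matrix.vecCons]
    rw [h]
    simp [pow_succ, curryLeftCLM_apply]

/-- The integrand of the homotopy operator of the Poincaré lemma. -/
noncomputable def homotopyIntegrand (β : E → E [⋀^Fin (n + 1)]→L[ℝ] G) (z : E × ℝ) :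
    E [⋀^Fin n]→L[ℝ] G :=
  z.2 ^ n • curryLeftCLM E G n (β (z.2 • z.1)) z.1

theorem contDiff_homotopyIntegrand {β : E → E [⋀^Fin (n + 1)]→L[ℝ] G} (hβ : ContDiff ℝ ∞ β) :
    ContDiff ℝ ∞ (homotopyIntegrand β) :=
  (contDiff_snd.pow n).smul (((curryLeftCLM E G n).contDiff.comp
    (hβ.comp (contDiff_snd.smul contDiff_fst))).clm_apply contDiff_fst)

theorem fderiv_homotopyIntegrand_comp_inl {β : E → E [⋀^Fin (n + 1)]→L[ℝ] G}
    (hβ : ContDiff ℝ ∞ β) (x : E) (t : ℝ) :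
    (fderiv ℝ (homotopyIntegrand β) (x, t)).comp (ContinuousLinearMap.inl ℝ E ℝ) =
      t ^ n • (t • ((curryLeftCLM E G n).flip x).comp (fderiv ℝ β (t • x)) +
        curryLeftCLM E G n (β (t • x))) := by
  have h1 : HasFDerivAt (fun y => homotopyIntegrand β (y, t))
      ((fderiv ℝ (homotopyIntegrand β) (x, t)).comp (ContinuousLinearMap.inl ℝ E ℝ)) x :=
    HasFDerivAt.comp (g := homotopyIntegrand β) (f := fun y => (y, t)) x
      ((contDiff_homotopyIntegrand hβ).differentiable (by simp) (x, t)).hasFDerivAt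
      (hasFDerivAt_prodMk_left x t)
  have h2 : HasFDerivAt (fun y : E => β (t • y))
      ((fderiv ℝ β (t • x)).comp (t • ContinuousLinearMap.id ℝ E)) x :=
    ((hβ.differentiable (by simp) (t • x)).hasFDerivAt).comp x ((hasFDerivAt_id x).const_smul t)
  have h2' : HasFDerivAt (fun y : E => curryLeftCLM E G n (β (t • y)))
      ((curryLeftCLM E G n).comp ((fderiv ℝ β (t • x)).comp (t • ContinuousLinearMap.id ℝ E))) x :=
    HasFDerivAt.comp (g := curryLeftCLM E G n) (f := fun y : E => β (t • y)) x
      (curryLeftCLM E G n).hasFDerivAt h2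
  have h3 := (h2'.clm_apply (hasFDerivAt_id x)).const_smul (t ^ n)
  refine (h1.unique h3).trans ?_
  ext v
  simp [add_comm]

/-- With `ι_x dβ = 0`, the Cartan formula turns the alternatization of `ι_x ∘ Dβ` into `Dβ x`, while
alternatizing `y ↦ ι_y β` counts `β` once per slot, giving `n + 1`. The right side is the
`t`-derivative of `t^(n+1) β(t x)`. -/
theorem alternatizeUncurryFin_fderiv_homotopyIntegrand {β : E → E [⋀^Fin (n + 1)]→L[ℝ] G}
    (hβ : ContDiff ℝ ∞ β) (hd : extDeriv β = 0) (x : E) (t : ℝ) :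
    alternatizeUncurryFin
      ((fderiv ℝ (homotopyIntegrand β) (x, t)).comp (ContinuousLinearMap.inl ℝ E ℝ)) =
      t ^ (n + 1) • fderiv ℝ β (t • x) x + ((n + 1 : ℝ) * t ^ n) • β (t • x) := by
  have h := curryLeft_alternatizeUncurryFin (fderiv ℝ β (t • x)) x
  rw [show alternatizeUncurryFin (fderiv ℝ β (t • x)) = 0 from congrFun hd (t • x),
    curryLeft_zero, _root_.zero_apply, eq_comm, sub_eq_zero] at h
  rw [fderiv_homotopyIntegrand_comp_inl hβ, alternatizeUncurryFin_smul,
    alternatizeUncurryFin_add, alternatizeUncurryFin_smul, ← h,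
    show curryLeftCLM E G n (β (t • x)) = (β (t • x)).curryLeft from rfl,
    alternatizeUncurryFin_curryLeft, ← Nat.cast_smul_eq_nsmul ℝ, smul_add, smul_smul, smul_smul,
    ← pow_succ]
  congr 2
  push_cast
  ring

/-- The Poincaré lemma: a closed smooth form of positive degree on a finite-dimensional space is
exact. -/
theorem exists_extDeriv_eq_of_extDeriv_eq_zero [ProperSpace E] [CompleteSpace G]
    {β : E → E [⋀^Fin (n + 1)]→L[ℝ] G} (hβ : ContDiff ℝ ∞ β) (hd : extDeriv β = 0) :
    ∃ η : E → E [⋀^Fin n]→L[ℝ] G, ContDiff ℝ ∞ η ∧ extDeriv η = β := by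
  have hs := contDiff_homotopyIntegrand hβ
  refine ⟨fun x => ∫ t in (0 : ℝ)..1, homotopyIntegrand β (x, t),
    contDiff_intervalIntegral hs 0 1, funext fun x => ?_⟩
  have hF : ∀ t : ℝ, HasDerivAt (fun t : ℝ => t ^ (n + 1) • β (t • x))
      (alternatizeUncurryFinCLM ℝ E G
        ((fderiv ℝ (homotopyIntegrand β) (x, t)).comp (ContinuousLinearMap.inl ℝ E ℝ))) t := by
    intro t
    rw [alternatizeUncurryFinCLM_apply, alternatizeUncurryFin_fderiv_homotopyIntegrand hβ hd]
    have h1 : HasDerivAt (fun t : ℝ => t • x) x t := by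
      simpa using (hasDerivAt_id t).smul_const x
    have h2 := ((hβ.differentiable (by simp) (t • x)).hasFDerivAt).comp_hasDerivAt t h1
    exact ((hasDerivAt_pow (n + 1) t).smul h2).congr_deriv (by simp)
  refine (clm_fderiv_intervalIntegral_eq_sub (hs.of_le (by simp)) 0 1 x
    (alternatizeUncurryFinCLM ℝ E G) hF).trans ?_
  -- The endpoint `t = 0` contributes nothing because the exponent `n + 1` is positive.
  simp

end Poincare

/-! ### Descent to finitely many coordinates and exactness -/

theorem coordProj_surjective {p q : ℕ} (F : Finset (Coord p q)) :
    Function.Surjective (coordProj F) := by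
  classical
  intro x
  refine ⟨fun c => if h : c ∈ F then x ⟨c, h⟩ else 0, funext fun a => ?_⟩
  simp [coordProj]

/-- Needed to pass from `d_v σ = 0` on the infinite product to closedness of the representative on
`ℝ^F`; it follows by lifting points and vectors through the projection. -/
theorem pullbackForm_injective {p q k l : ℕ} (F : Finset (Coord p q)) :
    Function.Injective (pullbackForm (k := k) (l := l) F) := by
  intro β γ h
  funext x
  obtain ⟨u, rfl⟩ := coordProj_surjective F x
  ext1 v
  choose w hw using fun i => coordProj_surjective F (v i)
  obtain rfl : coordProj F ∘ w = v := funext hw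
  exact DFunLike.congr_fun (congrFun h u) w

theorem dv_eq_pullbackForm {p q k l : ℕ} (σ : Omega p q k l) (n : Fin p → ℤ)
    {F : Finset (Coord p q)} {β : (F → ℝ) → (F → ℝ) [⋀^Fin l]→L[ℝ] HCovector p k}
    (hβ : ContDiff ℝ ∞ β) (h : σ.1 n = pullbackForm F β) :
    (dv p q k l σ).1 n = pullbackForm F ((-1 : ℝ) ^ k • extDeriv β) := by
  funext u
  ext1 w
  rw [dv_apply, h, vertDerivAt_pullbackForm hβ]
  rfl

theorem mainTheorem1 (p q k : ℕ) (hk : k ≤ p) :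
    ∀ l : ℕ, Function.Exact (dv p q k l) (dv p q k (l + 1)) := by
  intro l σ
  have hsign : (-1 : ℝ) ^ k * (-1 : ℝ) ^ k = 1 := by rw [← mul_pow]; simp
  constructor
  · intro hσ
    have key : ∀ n, ∃ (F : Finset (Coord p q))
        (η : (F → ℝ) → (F → ℝ) [⋀^Fin l]→L[ℝ] HCovector p k),
        ContDiff ℝ ∞ η ∧ σ.1 n = pullbackForm F (extDeriv η) := by
      intro n
      obtain ⟨F, β, hβ, e⟩ := σ.2 n
      have h0 : pullbackForm F ((-1 : ℝ) ^ k • extDeriv β) = pullbackForm F 0 := by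
        rw [← dv_eq_pullbackForm σ n hβ e, hσ]
        rfl
      have hd : extDeriv β = 0 :=
        (smul_eq_zero.1 (pullbackForm_injective F h0)).resolve_left (by simp)
      obtain ⟨η, hη, rfl⟩ := exists_extDeriv_eq_of_extDeriv_eq_zero hβ hd
      exact ⟨F, η, hη, e⟩
    -- `F` may vary with `n`, since finiteness is required only fibre by fibre.
    choose F η hη e using key
    -- The primitive carries the sign `(-1)^k` to cancel the one in `d_v`.
    have hη' : ∀ n, ContDiff ℝ ∞ ((-1 : ℝ) ^ k • η n) := fun n => (hη n).const_smul ((-1 : ℝ) ^ k)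
    refine ⟨⟨fun n => pullbackForm (F n) ((-1 : ℝ) ^ k • η n),
      fun n => ⟨F n, _, hη' n, rfl⟩⟩, Subtype.ext (funext fun n => ?_)⟩
    rw [dv_eq_pullbackForm _ n (hη' n) rfl, e n]
    congr 1
    funext x
    rw [Pi.smul_apply]
    exact (congrArg _ (extDeriv_smul _ _)).trans (by rw [smul_smul, hsign, one_smul])
  · rintro ⟨τ, rfl⟩
    refine Subtype.ext (funext fun n => ?_)
    obtain ⟨F, β, hβ, e⟩ := τ.2 n
    have hc : ContDiff ℝ ∞ ((-1 : ℝ) ^ k • extDeriv β) :=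
      (contDiff_extDeriv hβ).const_smul ((-1 : ℝ) ^ k)
    rw [dv_eq_pullbackForm _ n hc
      (dv_eq_pullbackForm τ n hβ e)]
    -- This is `d ∘ d = 0`, for which `C^2` regularity suffices.
    have h0 : extDeriv ((-1 : ℝ) ^ k • extDeriv β) = 0 := by
      funext x
      rw [extDeriv_smul, extDeriv_extDeriv (r := 2) (contDiff_infty.1 hβ 2) (by simp)]
      simp
    rw [h0, smul_zero]
    rfl
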